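/- Let $\nu$ be a L\'evy measure on $\mathbb R$, i.e. a Borel measure with $\nu(\{0\})=0$ and $\int_{|z|<1}|z|^2\,\nu(dz)+\int_{|z|\ge 1}\nu(dz)<\infty$. Assume: (A1) there are $p\in(0,2)$ and $C>0$ such that $\int_{|z|\le\delta}|z|^2\,\nu(dz)\ge C\,\delta^{2-p}$ for every $0<\delta\le 1$; (A3) there is $q>0$ such that $\int_{|z|>1}|z|^q\,\nu(dz)<\infty$; (A2) at least one of the following holds: (i) the exponent $p$ in (A1) lies in $(1,2)$; (ii) $\mathbb R=\bigcup_{n\ge 0}\big(\underbrace{\operatorname{supp}\nu+\dots+\operatorname{supp}\nu}_{n}\big)$, where the empty sum ($n=0$) is $\{0\}$. Let $\mathcal I$ be the generator of the Ornstein--Uhlenbeck process driven by the pure-jump L\'evy process with L\'evy measure $\nu$, $$\mathcal I[y,f]=-f'(y)\,y+\int_{\mathbb R}\big(f(y+z)-f(y)-f'(y)\,z\,\mathbf 1_{\{|z|\le 1\}}\big)\,\nu(dz).$$ A viscosity subsolution (resp. supersolution) of $-\mathcal I[y,V]=0$ on $\mathbb R$ is an upper (resp. lower) semicontinuous function $V:\mathbb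 R\to\mathbb R$ such that $-\mathcal I[y,\varphi]\le 0$ (resp. $\ge 0$) for every $y\in\mathbb R$ and every $\varphi\in C^2(\mathbb R)$ for which $V-\varphi$ has a global maximum (resp. minimum) at $y$ and the integrand in $\mathcal I[y,\varphi]$ is $\nu$-integrable. Then: 1. every bounded viscosity subsolution of $-\mathcal I[y,V]=0$ on $\mathbb R$ is constant; 2. every bounded viscosity supersolution of $-\mathcal I[y,V]=0$ on $\mathbb R$ is constant. -/

import Mathlib

open MeasureTheory Set

noncomputable section

namespace LevyOU

/-- A Lévy measure on the real line: no mass at the origin, and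
`∫_{|z| < 1} |z|² ν(dz) + ∫_{|z| ≥ 1} ν(dz) < ∞`. -/
structure IsLevyMeasure (ν : Measure ℝ) : Prop where
  zero_mass : ν {0} = 0
  integrability :
    (∫⁻ z in {z : ℝ | |z| < 1}, ENNReal.ofReal (|z| ^ 2) ∂ν) + ν {z : ℝ | 1 ≤ |z|} < ⊤

/-- Nondegeneracy at the origin with exponent `p ∈ (0,2)`: there is `C > 0` such that
`∫_{|z| ≤ δ} |z|² ν(dz) ≥ C δ^(2-p)` for all `0 < δ ≤ 1`. -/
def Nondegenerate (ν : Measure ℝ) (p : ℝ) : Prop :=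
  p ∈ Ioo (0 : ℝ) 2 ∧ ∃ C : ℝ, 0 < C ∧ ∀ δ : ℝ, 0 < δ → δ ≤ 1 →
    ENNReal.ofReal (C * δ ^ (2 - p)) ≤
      ∫⁻ z in {z : ℝ | |z| ≤ δ}, ENNReal.ofReal (|z| ^ 2) ∂ν

/-- Moment condition at infinity: `∫_{|z| > 1} |z|^q ν(dz) < ∞` for some `q > 0`. -/
def HasMomentAtInfinity (ν : Measure ℝ) : Prop :=
  ∃ q : ℝ, 0 < q ∧ (∫⁻ z in {z : ℝ | 1 < |z|}, ENNReal.ofReal (|z| ^ q) ∂ν) < ⊤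

/-- The `n`-fold Minkowski sum `S + ⋯ + S` (equal to `{0}` for `n = 0`). -/
def nfoldSum (S : Set ℝ) (n : ℕ) : Set ℝ :=
  {x | ∃ s : Fin n → ℝ, (∀ i, s i ∈ S) ∧ x = ∑ i, s i}

/-- The real line is covered by the iterated Minkowski sums of the support of `ν`. -/
def SupportCovers (ν : Measure ℝ) : Prop :=
  (univ : Set ℝ) = ⋃ n : ℕ, nfoldSum ν.support n

/-- The integrand `f(y+z) - f(y) - f'(y) z 1_{|z| ≤ 1}` of the nonlocal term at `y`. -/
def jumpIntegrand (f : ℝ → ℝ) (y z : ℝ) : ℝ :=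
  f (y + z) - f y - deriv f y * {z : ℝ | |z| ≤ 1}.indicator (fun z => z) z

/-- The generator of the Ornstein-Uhlenbeck process driven by the pure jump Lévy process with
Lévy measure `ν`:
`I[y, f] = - f'(y) y + ∫ (f(y+z) - f(y) - f'(y) z 1_{|z| ≤ 1}) ν(dz)`. -/
def generator (ν : Measure ℝ) (f : ℝ → ℝ) (y : ℝ) : ℝ :=
  -(deriv f y * y) + ∫ z, jumpIntegrand f y z ∂ν

/-- Viscosity subsolutions of `-I[y, V] = 0` on `ℝ`: `V` is upper semicontinuous, and
`-I[y, φ] ≤ 0` whenever `φ` is `C²`, `V - φ` has a global maximum at `y`, and the nonlocal term of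
`φ` at `y` is finite. For bounded `V` the negative part of that term is always finite at such a
point, and where the term is `+∞` the inequality holds trivially, so no test function is lost. -/
def IsViscositySubsolution (ν : Measure ℝ) (V : ℝ → ℝ) : Prop :=
  UpperSemicontinuous V ∧
    ∀ (φ : ℝ → ℝ) (y : ℝ), ContDiff ℝ 2 φ → Integrable (jumpIntegrand φ y) ν →
      (∀ x, V x - φ x ≤ V y - φ y) → -generator ν φ y ≤ 0

/-- Viscosity supersolutions of `-I[y, V] = 0` on `ℝ`: `V` is lower semicontinuous, and
`-I[y, φ] ≥ 0` whenever `φ` is `C²`, `V - φ` has a global minimum at `y`, and the nonlocal term of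
`φ` at `y` is finite. -/
def IsViscositySupersolution (ν : Measure ℝ) (V : ℝ → ℝ) : Prop :=
  LowerSemicontinuous V ∧
    ∀ (φ : ℝ → ℝ) (y : ℝ), ContDiff ℝ 2 φ → Integrable (jumpIntegrand φ y) ν →
      (∀ x, V y - φ y ≤ V x - φ x) → 0 ≤ -generator ν φ y

end LevyOU

end

/-!
The Lyapunov function `log (1 + y²)` has generator tending to `-2` at infinity, so perturbing by
small multiples of it shows that a subsolution bounded above attains its maximum. Touching from
above with a bump shows that the closed set of maximum points is stable under translation by the
support of `ν`; if the support generates a dense submonoid, this set is the whole line.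

If the small jumps have infinite variation, we may assume by reflection that the positive ones do.
Then the support accumulates at `0` from the right, so the set of maximum points is an upper set,
and it is also a lower set if the support accumulates at `0` from the left. Otherwise the set
cannot have a least point `a`: the function `x - a`, cut off at distance `r` from `a`, has generator
at `a` at most a constant minus the compensator `∫_{[r, 1]} z ν(dz)`, which is negative for small
`r`, while a small multiple of it can be used as a test function near `a`.
-/

open Filter Topology Metric

namespace LevyOU

/-! ### Maxima of upper semicontinuous functions -/

section Maxima

variable {X : Type*} {V h : X → ℝ}

/-- The set of global maximum points of a function. -/
def argmax (V : X → ℝ) : Set X := {x | ∀ y, V y ≤ V x}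

lemma lt_of_notMem_argmax {a x : X} (ha : a ∈ argmax V) (hx : x ∉ argmax V) : V x < V a := by
  by_contra! hax
  exact hx fun y => (ha y).trans hax

lemma argmax_comp {Y : Type*} {e : Y → X} (he : Function.Surjective e) :
    argmax (V ∘ e) = e ⁻¹' argmax V :=
  ext fun x => (he.forall (p := fun y => V y ≤ V (e x))).symm

variable [TopologicalSpace X]

lemma upperSemicontinuous_sub_continuous (hV : UpperSemicontinuous V) (hh : Continuous h) :
    UpperSemicontinuous fun x => V x - h x := by
  simpa only [sub_eq_add_neg] using
    hV.add (show Continuous fun x => -h x by fun_prop).upperSemicontinuous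

lemma exists_forall_sub_le_of_tendsto_cocompact [Nonempty X] (hV : UpperSemicontinuous V)
    (hbdd : BddAbove (range V)) (hh : Continuous h) (hlim : Tendsto h (cocompact X) atTop) :
    ∃ y, ∀ x, V x - h x ≤ V y - h y := by
  obtain ⟨K, hK⟩ := hbdd
  let x₀ := Classical.arbitrary X
  obtain ⟨C, hC, hCh⟩ := mem_cocompact.1 (hlim.eventually_ge_atTop (K - (V x₀ - h x₀)))
  obtain ⟨y, -, hy⟩ := ((upperSemicontinuous_sub_continuous hV hh).upperSemicontinuousOn
    (insert x₀ C)).exists_isMaxOn (insert_nonempty x₀ C) (hC.insert x₀)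
  refine ⟨y, fun x => ?_⟩
  by_cases hx : x ∈ C
  · exact hy (mem_insert_of_mem x₀ hx)
  · have hfar : K - (V x₀ - h x₀) ≤ h x := hCh hx
    have hx₀ : V x₀ - h x₀ ≤ V y - h y := hy (mem_insert x₀ C)
    linarith [hK (mem_range_self x)]

lemma exists_lt_forall_mem_le (hV : UpperSemicontinuous V) {C : Set X} (hC : IsCompact C) {v : ℝ}
    (hlt : ∀ x ∈ C, V x < v) : ∃ w < v, ∀ x ∈ C, V x ≤ w := by
  rcases C.eq_empty_or_nonempty with rfl | hne
  · exact ⟨v - 1, sub_one_lt v, fun x hx => hx.elim⟩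
  · obtain ⟨m, hmC, hm⟩ := (hV.upperSemicontinuousOn C).exists_isMaxOn hne hC
    exact ⟨V m, hlt m hmC, fun x hx => hm hx⟩

/-- For small `ε`, the perturbation `ε * h` is too weak to move the maximum of `V` out of `U`. -/
lemma exists_pos_exists_mem_forall_sub_mul_le (hV : UpperSemicontinuous V) (hh : Continuous h)
    {a : X} {C U : Set X} (hC : IsCompact C) (haC : a ∈ C) (hU : U ∈ 𝓝 a)
    (hmax : ∀ x, V x ≤ V a) (hstrict : ∀ x ∈ C, x ≠ a → V x < V a) (hCh : ∀ x ∉ C, h a ≤ h x) :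
    ∃ ε > 0, ∃ y ∈ U, ∀ x, V x - ε * h x ≤ V y - ε * h y := by
  obtain ⟨w, hw, hVw⟩ := exists_lt_forall_mem_le hV (hC.diff isOpen_interior) (v := V a)
    fun x hx => hstrict x hx.1 fun h => hx.2 (h ▸ mem_interior_iff_mem_nhds.2 hU)
  obtain ⟨M, hM⟩ := hC.exists_bound_of_continuousOn
    (continuous_const.sub hh).continuousOn (f := fun x => h a - h x)
  have hM0 : 0 ≤ M := (norm_nonneg _).trans (hM a haC)
  set ε := (V a - w) / (M + 1)
  have hε : 0 < ε := div_pos (sub_pos.2 hw) (by linarith)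
  have hεM : ε * (M + 1) = V a - w := div_mul_cancel₀ _ (by linarith)
  obtain ⟨y, hyC, hy⟩ := ((upperSemicontinuous_sub_continuous hV
    (hh.const_mul ε)).upperSemicontinuousOn C).exists_isMaxOn ⟨a, haC⟩ hC
  have hya : V a - ε * h a ≤ V y - ε * h y := hy haC
  refine ⟨ε, hε, y, ?_, fun x => ?_⟩
  · by_contra hyU
    have hVy : V y ≤ w := hVw y ⟨hyC, fun h => hyU (interior_subset h)⟩
    have hhy : ε * (h a - h y) ≤ ε * M :=
      mul_le_mul_of_nonneg_left ((le_abs_self _).trans (hM y hyC)) hε.le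
    linarith
  · by_cases hx : x ∈ C
    · exact hy hx
    · linarith [hmax x, mul_le_mul_of_nonneg_left (hCh x hx) hε.le]

lemma isClosed_argmax (hV : UpperSemicontinuous V) : IsClosed (argmax V) := by
  simp only [argmax, ofPred_forall]
  exact isClosed_iInter fun y => hV.isClosed_preimage (V y)

end Maxima

/-! ### Closed sets stable under translations -/

section Translation

variable {G : Type*} {S T : Set G}

lemma add_mem_of_mem_closure [AddMonoid G] (hST : ∀ y ∈ S, ∀ t ∈ T, y + t ∈ S) {t : G}
    (ht : t ∈ AddSubmonoid.closure T) : ∀ y ∈ S, y + t ∈ S := by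
  induction ht using AddSubmonoid.closure_induction with
  | mem t ht => exact fun y hy => hST y hy t ht
  | zero => simp only [add_zero, imp_self, implies_true]
  | add s t _ _ hs ht => exact fun y hy => add_assoc y s t ▸ ht _ (hs y hy)

lemma eq_univ_of_dense_addSubmonoidClosure [AddGroup G] [TopologicalSpace G] [ContinuousAdd G]
    (hS : IsClosed S) (hne : S.Nonempty) (hST : ∀ y ∈ S, ∀ t ∈ T, y + t ∈ S)
    (hT : Dense (AddSubmonoid.closure T : Set G)) : S = univ := by
  obtain ⟨m, hm⟩ := hne
  have huniv : (m + ·) ⁻¹' S = univ := (hS.preimage (continuous_const_add m)).closure_eq ▸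
    (hT.mono fun t ht => add_mem_of_mem_closure hST ht m hm).closure_eq
  refine eq_univ_of_forall fun x => ?_
  simpa using (huniv ▸ mem_univ (-m + x) : -m + x ∈ (m + ·) ⁻¹' S)

variable [ConditionallyCompleteLinearOrder G] [AddCommGroup G] [IsOrderedAddMonoid G]
  [TopologicalSpace G] [OrderTopology G]

lemma isUpperSet_of_frequently_nhdsGT (hS : IsClosed S) (hST : ∀ y ∈ S, ∀ t ∈ T, y + t ∈ S)
    (hT : ∃ᶠ t in 𝓝[>] 0, t ∈ T) : IsUpperSet S := by
  intro a b hab ha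
  refine (hS.inter isClosed_Icc).Icc_subset_of_forall_exists_gt ha ?_ ⟨hab, le_rfl⟩
  intro x hx y hxy
  obtain ⟨t, htT, ht0, hty⟩ :=
    (hT.and_eventually (Ioc_mem_nhdsGT (sub_pos.2 hxy))).exists
  exact ⟨x + t, hST x hx.1 t htT, lt_add_of_pos_right x ht0, le_sub_iff_add_le'.1 hty⟩

lemma isLowerSet_of_frequently_nhdsLT (hS : IsClosed S) (hST : ∀ y ∈ S, ∀ t ∈ T, y + t ∈ S)
    (hT : ∃ᶠ t in 𝓝[<] 0, t ∈ T) : IsLowerSet S :=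
  fun _ _ hba hb => isUpperSet_of_frequently_nhdsGT (G := Gᵒᵈ) hS hST hT hba hb

end Translation

/-! ### Integrability against a Lévy measure -/

section Integrability

variable {ν : Measure ℝ} {f V : ℝ → ℝ} {y : ℝ}

lemma measurableSet_abs_le (δ : ℝ) : MeasurableSet {z : ℝ | |z| ≤ δ} :=
  measurableSet_le (by fun_prop) measurable_const

lemma IsLevyMeasure.integrable_min_one_sq (hν : IsLevyMeasure ν) :
    Integrable (fun z : ℝ => min 1 (z ^ 2)) ν := by
  obtain ⟨hsmall, hlarge⟩ := ENNReal.add_lt_top.1 hν.integrability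
  have hsq : IntegrableOn (fun z : ℝ => z ^ 2) {z : ℝ | |z| < 1} ν := by
    refine ⟨by fun_prop, ?_⟩
    rw [hasFiniteIntegral_iff_ofReal (Eventually.of_forall fun z => sq_nonneg z)]
    simpa only [sq_abs] using hsmall
  have hone : IntegrableOn (fun _ : ℝ => (1 : ℝ)) {z : ℝ | 1 ≤ |z|} ν :=
    integrableOn_const hlarge.ne
  have hmin : ∀ z : ℝ, ‖min 1 (z ^ 2)‖ = min 1 (z ^ 2) := fun z =>
    Real.norm_of_nonneg (le_min zero_le_one (sq_nonneg z))
  rw [← integrableOn_univ]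
  refine IntegrableOn.mono_set (t := {z : ℝ | |z| < 1} ∪ {z : ℝ | 1 ≤ |z|}) (.union ?_ ?_)
    fun z _ => lt_or_ge |z| 1
  · exact hsq.mono' (by fun_prop) <| .of_forall fun z => (hmin z).trans_le (min_le_right _ _)
  · exact hone.mono' (by fun_prop) <| .of_forall fun z => (hmin z).trans_le (min_le_left _ _)

lemma IsLevyMeasure.integrableOn_sq (hν : IsLevyMeasure ν) :
    IntegrableOn (fun z : ℝ => z ^ 2) {z : ℝ | |z| ≤ 1} ν :=
  hν.integrable_min_one_sq.integrableOn.congr_fun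
    (fun _ hz => min_eq_right ((sq_le_one_iff_abs_le_one _).2 hz)) (measurableSet_abs_le 1)

lemma IsLevyMeasure.measure_le_abs_lt_top (hν : IsLevyMeasure ν) {δ : ℝ} (hδ : 0 < δ) :
    ν {z : ℝ | δ ≤ |z|} < ⊤ := by
  refine (measure_mono fun z (hz : δ ≤ |z|) => ?_).trans_lt
    (hν.integrable_min_one_sq.measure_norm_ge_lt_top (ε := min 1 (δ ^ 2)) (by positivity))
  have hsq : δ ^ 2 ≤ z ^ 2 := sq_abs z ▸ pow_le_pow_left₀ hδ.le hz 2
  exact (min_le_min_left 1 hsq).trans (le_abs_self _)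

lemma IsLevyMeasure.integrableOn_const (hν : IsLevyMeasure ν) (c : ℝ) :
    IntegrableOn (fun _ => c) {z : ℝ | 1 < |z|} ν :=
  MeasureTheory.integrableOn_const
    ((measure_mono fun z (hz : 1 < |z|) => hz.le).trans_lt (hν.measure_le_abs_lt_top one_pos)).ne

lemma norm_sub_sub_smul_deriv_le {E : Type*} [NormedAddCommGroup E] [NormedSpace ℝ E]
    {f : ℝ → E} {L : NNReal} {y z : ℝ} (hf : ∀ x ∈ closedBall y |z|, DifferentiableAt ℝ f x)
    (hL : LipschitzOnWith L (deriv f) (closedBall y |z|)) :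
    ‖f (y + z) - f y - z • deriv f y‖ ≤ L * z ^ 2 := by
  have hy : y ∈ closedBall y |z| := mem_closedBall_self (abs_nonneg z)
  have hbound : ∀ x ∈ closedBall y |z|,
      ‖fderiv ℝ f x - ContinuousLinearMap.toSpanSingleton ℝ (deriv f y)‖ ≤ L * |z| := by
    intro x hx
    rw [← toSpanSingleton_deriv, ← dist_eq_norm]
    exact ((ContinuousLinearMap.toSpanSingletonLIE ℝ E).dist_map _ _).trans_le <|
      (hL.dist_le_mul x hx y hy).trans (mul_le_mul_of_nonneg_left hx L.coe_nonneg)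
  simpa [mul_assoc, ← sq] using (convex_closedBall y |z|).norm_image_sub_le_of_norm_fderiv_le'
    hf hbound hy (show y + z ∈ closedBall y |z| by simp)

/-- The standard majorant of the integrand of the nonlocal term: `L * z ^ 2` for the compensated
small jumps and `G z` for the large ones. -/
noncomputable def jumpBound (L : ℝ) (G : ℝ → ℝ) (z : ℝ) : ℝ := if |z| ≤ 1 then L * z ^ 2 else G z

lemma IsLevyMeasure.integrable_jumpBound (hν : IsLevyMeasure ν) (L : ℝ) {G : ℝ → ℝ}
    (hG : IntegrableOn G {z : ℝ | 1 < |z|} ν) : Integrable (jumpBound L G) ν :=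
  Integrable.piecewise (s := {z : ℝ | |z| ≤ 1}) (measurableSet_abs_le 1)
    (hν.integrableOn_sq.const_mul L) (by simpa only [compl_ofPred, not_le] using hG)

lemma measurable_jumpIntegrand (hf : Continuous f) (y : ℝ) : Measurable (jumpIntegrand f y) := by
  have hind : Measurable ({z : ℝ | |z| ≤ 1}.indicator fun z => z) :=
    measurable_id.indicator (measurableSet_abs_le 1)
  unfold jumpIntegrand
  fun_prop

lemma abs_jumpIntegrand_le (hf : Differentiable ℝ f) {L : NNReal} {G : ℝ → ℝ}
    (hL : LipschitzOnWith L (deriv f) (closedBall y 1))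
    (hG : ∀ z, 1 < |z| → |f (y + z) - f y| ≤ G z) (z : ℝ) :
    |jumpIntegrand f y z| ≤ jumpBound L G z := by
  by_cases hz : |z| ≤ 1
  · simpa [jumpIntegrand, jumpBound, hz, mul_comm] using norm_sub_sub_smul_deriv_le
      (fun x _ => hf x) (hL.mono (closedBall_subset_closedBall hz))
  · simpa [jumpIntegrand, jumpBound, hz] using hG z (not_le.1 hz)

lemma exists_lipschitzOnWith_deriv (hf : ContDiff ℝ 2 f) (a : ℝ) :
    ∃ L, ∀ y ∈ closedBall a 1, LipschitzOnWith L (deriv f) (closedBall y 1) := by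
  have hf' : ContDiff ℝ 1 (deriv f) := ((contDiff_succ_iff_deriv (n := 1)).1 hf).2.2
  obtain ⟨L, hL⟩ := hf'.contDiffOn.exists_lipschitzOnWith one_ne_zero
    (convex_closedBall a 2) (isCompact_closedBall a 2)
  refine ⟨L, fun y hy => hL.mono (closedBall_subset_closedBall' ?_)⟩
  linarith [mem_closedBall.1 hy]

lemma abs_add_sub_le {K : ℝ} (hK : ∀ x, |f x| ≤ K) (y z : ℝ) : |f (y + z) - f y| ≤ K + K :=
  (abs_sub _ _).trans (add_le_add (hK _) (hK _))

lemma IsLevyMeasure.integrable_jumpIntegrand (hν : IsLevyMeasure ν) (hf : ContDiff ℝ 2 f) {K : ℝ}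
    (hK : ∀ x, |f x| ≤ K) (y : ℝ) : Integrable (jumpIntegrand f y) ν := by
  obtain ⟨L, hL⟩ := exists_lipschitzOnWith_deriv hf y
  exact (hν.integrable_jumpBound L (hν.integrableOn_const (K + K))).mono'
    (measurable_jumpIntegrand hf.continuous y).aestronglyMeasurable <| .of_forall <|
    abs_jumpIntegrand_le (hf.differentiable two_ne_zero)
      (hL y (mem_closedBall_self zero_le_one)) fun z _ => abs_add_sub_le hK y z

lemma IsLevyMeasure.continuous_generator (hν : IsLevyMeasure ν) (hf : ContDiff ℝ 2 f) {K : ℝ}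
    (hK : ∀ x, |f x| ≤ K) : Continuous (generator ν f) := by
  have hfc : Continuous f := hf.continuous
  have hf' : Continuous (deriv f) := hf.continuous_deriv one_le_two
  have hjump : Continuous fun y => ∫ z, jumpIntegrand f y z ∂ν := by
    refine continuous_iff_continuousAt.2 fun a => ?_
    obtain ⟨L, hL⟩ := exists_lipschitzOnWith_deriv hf a
    refine continuousAt_of_dominated
      (.of_forall fun y => (measurable_jumpIntegrand hfc y).aestronglyMeasurable) ?_
      (hν.integrable_jumpBound L (hν.integrableOn_const (K + K))) (.of_forall fun z => ?_)
    · filter_upwards [closedBall_mem_nhds a one_pos] with y hy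
      exact .of_forall <| abs_jumpIntegrand_le (hf.differentiable two_ne_zero) (hL y hy)
        fun z _ => abs_add_sub_le hK y z
    · unfold jumpIntegrand
      fun_prop
  exact (hf'.mul continuous_id).neg.add hjump

lemma jumpIntegrand_const_mul (ε : ℝ) (f : ℝ → ℝ) (y : ℝ) :
    jumpIntegrand (fun x => ε * f x) y = fun z => ε * jumpIntegrand f y z := by
  ext z
  simp only [jumpIntegrand, deriv_const_mul_field']
  ring

lemma generator_const_mul (ν : Measure ℝ) (ε : ℝ) (f : ℝ → ℝ) (y : ℝ) :
    generator ν (fun x => ε * f x) y = ε * generator ν f y := by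
  simp only [generator, jumpIntegrand_const_mul, integral_const_mul, deriv_const_mul_field']
  ring

lemma IsViscositySubsolution.generator_nonneg (hV : IsViscositySubsolution ν V)
    (hf : ContDiff ℝ 2 f) (hi : Integrable (jumpIntegrand f y) ν) {ε : ℝ} (hε : 0 < ε)
    (hmax : ∀ x, V x - ε * f x ≤ V y - ε * f y) : 0 ≤ generator ν f y := by
  have hgen := hV.2 (fun x => ε * f x) y (contDiff_const.mul hf)
    (jumpIntegrand_const_mul ε f y ▸ hi.const_mul ε) hmax
  rw [generator_const_mul, neg_nonpos] at hgen
  exact nonneg_of_mul_nonneg_right hgen hε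

end Integrability

/-! ### The Lyapunov function and existence of maxima -/

section Lyapunov

variable {ν : Measure ℝ} {V : ℝ → ℝ}

/-- The logarithmic moment condition `∫_{|z| > 1} log |z| ν(dz) < ∞`, which already makes the
Ornstein-Uhlenbeck dynamics confining. -/
def HasLogMomentAtInfinity (ν : Measure ℝ) : Prop :=
  ∫⁻ z in {z : ℝ | 1 < |z|}, ENNReal.ofReal (Real.log |z|) ∂ν < ⊤

lemma HasLogMomentAtInfinity.integrableOn_log_abs (h : HasLogMomentAtInfinity ν) :
    IntegrableOn (fun z => Real.log |z|) {z : ℝ | 1 < |z|} ν := by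
  have hmeas : MeasurableSet {z : ℝ | 1 < |z|} := measurableSet_lt measurable_const (by fun_prop)
  refine ⟨(Real.measurable_log.comp measurable_norm).aestronglyMeasurable, ?_⟩
  rwa [hasFiniteIntegral_iff_ofReal <| (ae_restrict_iff' hmeas).2 <|
    .of_forall fun z (hz : 1 < |z|) => Real.log_nonneg hz.le]

/-- The Lyapunov function `log (1 + y²)` of the Ornstein-Uhlenbeck dynamics. -/
noncomputable def lyapunov (y : ℝ) : ℝ := Real.log (1 + y ^ 2)

lemma lyapunov_nonneg (y : ℝ) : 0 ≤ lyapunov y :=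
  Real.log_nonneg (le_add_of_nonneg_right (sq_nonneg y))

lemma contDiff_lyapunov : ContDiff ℝ 2 lyapunov :=
  (contDiff_const.add (contDiff_id.pow 2)).log fun y => (by positivity : (1 : ℝ) + id y ^ 2 ≠ 0)

lemma deriv_lyapunov (y : ℝ) : deriv lyapunov y = 2 * y / (1 + y ^ 2) := by
  have h : HasDerivAt (fun y : ℝ => 1 + y ^ 2) (2 * y) y := by
    simpa using (hasDerivAt_pow 2 y).const_add 1
  exact (h.log (by positivity)).deriv

lemma lipschitzWith_deriv_lyapunov : LipschitzWith 2 (deriv lyapunov) := by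
  refine .of_dist_le_mul fun x y => ?_
  have hfactor : deriv lyapunov x - deriv lyapunov y
      = 2 * (x - y) * ((1 - x * y) / ((1 + x ^ 2) * (1 + y ^ 2))) := by
    rw [deriv_lyapunov, deriv_lyapunov]
    field_simp
    ring
  have hle : |(1 - x * y) / ((1 + x ^ 2) * (1 + y ^ 2))| ≤ 1 := by
    rw [abs_div, abs_of_pos (show 0 < (1 + x ^ 2) * (1 + y ^ 2) by positivity),
      div_le_one (by positivity), abs_le]
    constructor <;> nlinarith [sq_nonneg (x - y), sq_nonneg (x + y), sq_nonneg (x * y)]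
  rw [Real.dist_eq, Real.dist_eq, hfactor, abs_mul, abs_mul, abs_two]
  exact mul_le_of_le_one_right (by positivity) hle

lemma lyapunov_add_le (y z : ℝ) :
    lyapunov (y + z) ≤ Real.log 2 + lyapunov z + lyapunov y := by
  unfold lyapunov
  rw [← Real.log_mul (by norm_num) (by positivity), ← Real.log_mul (by positivity) (by positivity)]
  refine Real.log_le_log (by positivity) ?_
  nlinarith [sq_nonneg (y - z), sq_nonneg (y * z)]

lemma lyapunov_le_log_abs {z : ℝ} (hz : 1 < |z|) :
    lyapunov z ≤ Real.log 2 + 2 * Real.log |z| := by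
  have hsq : 1 + z ^ 2 ≤ 2 * |z| ^ 2 := by
    rw [two_mul, sq_abs]
    gcongr
    exact (one_lt_sq_iff_one_lt_abs z).2 hz |>.le
  have hz0 : |z| ≠ 0 := (one_pos.trans hz).ne'
  calc lyapunov z ≤ Real.log (2 * |z| ^ 2) := Real.log_le_log (by positivity) hsq
    _ = Real.log 2 + 2 * Real.log |z| := by
      rw [Real.log_mul two_ne_zero (pow_ne_zero 2 hz0), Real.log_pow, Nat.cast_ofNat]

lemma abs_lyapunov_add_sub_le (y : ℝ) {z : ℝ} (hz : 1 < |z|) :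
    |lyapunov (y + z) - lyapunov y| ≤ 2 * Real.log 2 + 2 * Real.log |z| := by
  have hup := lyapunov_add_le y z
  have hdown := lyapunov_add_le (y + z) (-z)
  have heven : lyapunov (-z) = lyapunov z := by simp only [lyapunov, neg_sq]
  rw [add_neg_cancel_right, heven] at hdown
  have hz := lyapunov_le_log_abs hz
  rw [abs_le]
  constructor <;> linarith

lemma abs_jumpIntegrand_lyapunov_le (y z : ℝ) :
    |jumpIntegrand lyapunov y z|
      ≤ jumpBound 2 (fun z => 2 * Real.log 2 + 2 * Real.log |z|) z :=
  abs_jumpIntegrand_le (contDiff_lyapunov.differentiable two_ne_zero)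
    lipschitzWith_deriv_lyapunov.lipschitzOnWith (fun _ => abs_lyapunov_add_sub_le y) z

lemma IsLevyMeasure.integrable_jumpBound_lyapunov (hν : IsLevyMeasure ν)
    (h : HasLogMomentAtInfinity ν) :
    Integrable (jumpBound 2 fun z => 2 * Real.log 2 + 2 * Real.log |z|) ν :=
  hν.integrable_jumpBound 2 ((hν.integrableOn_const _).add (h.integrableOn_log_abs.const_mul 2))

lemma IsLevyMeasure.integrable_jumpIntegrand_lyapunov (hν : IsLevyMeasure ν)
    (h : HasLogMomentAtInfinity ν) (y : ℝ) : Integrable (jumpIntegrand lyapunov y) ν :=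
  (hν.integrable_jumpBound_lyapunov h).mono'
    (measurable_jumpIntegrand contDiff_lyapunov.continuous y).aestronglyMeasurable
    (.of_forall (abs_jumpIntegrand_lyapunov_le y))

lemma tendsto_one_add_sq_cocompact :
    Tendsto (fun y : ℝ => 1 + y ^ 2) (cocompact ℝ) atTop := by
  refine tendsto_atTop_add_const_left _ _ ?_
  simpa [Function.comp_def] using
    (tendsto_pow_atTop two_ne_zero).comp (tendsto_norm_cocompact_atTop (E := ℝ))

lemma tendsto_inv_one_add_sq_cocompact :
    Tendsto (fun y : ℝ => (1 + y ^ 2)⁻¹) (cocompact ℝ) (𝓝 0) :=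
  tendsto_inv_atTop_zero.comp tendsto_one_add_sq_cocompact

lemma tendsto_lyapunov_cocompact : Tendsto lyapunov (cocompact ℝ) atTop :=
  Real.tendsto_log_atTop.comp tendsto_one_add_sq_cocompact

lemma tendsto_deriv_lyapunov_mul_cocompact :
    Tendsto (fun y => deriv lyapunov y * y) (cocompact ℝ) (𝓝 2) := by
  have h : Tendsto (fun y : ℝ => 2 - 2 * (1 + y ^ 2)⁻¹) (cocompact ℝ) (𝓝 2) := by
    simpa using (tendsto_inv_one_add_sq_cocompact.const_mul 2).const_sub 2
  refine h.congr fun y => ?_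
  rw [deriv_lyapunov]
  field_simp
  ring

lemma tendsto_deriv_lyapunov_cocompact : Tendsto (deriv lyapunov) (cocompact ℝ) (𝓝 0) := by
  have hinv : Tendsto (fun y : ℝ => y⁻¹) (cocompact ℝ) (𝓝 0) :=
    cobounded_eq_cocompact (α := ℝ) ▸ tendsto_inv₀_cobounded
  have h := tendsto_deriv_lyapunov_mul_cocompact.mul hinv
  rw [mul_zero] at h
  refine h.congr' ?_
  filter_upwards [(isCompact_singleton (x := (0 : ℝ))).compl_mem_cocompact] with y hy
  exact mul_inv_cancel_right₀ hy _

lemma tendsto_lyapunov_add_sub_cocompact (z : ℝ) :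
    Tendsto (fun y => lyapunov (y + z) - lyapunov y) (cocompact ℝ) (𝓝 0) := by
  have hratio : Tendsto (fun y : ℝ => 1 + (z * deriv lyapunov y + z ^ 2 * (1 + y ^ 2)⁻¹))
      (cocompact ℝ) (𝓝 1) := by
    simpa using ((tendsto_deriv_lyapunov_cocompact.const_mul z).add
      (tendsto_inv_one_add_sq_cocompact.const_mul (z ^ 2))).const_add 1
  rw [← Real.log_one]
  refine (hratio.log one_ne_zero).congr fun y => ?_
  rw [deriv_lyapunov, lyapunov, lyapunov, ← Real.log_div (by positivity) (by positivity)]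
  congr 1
  field_simp
  ring

lemma IsLevyMeasure.tendsto_generator_lyapunov (hν : IsLevyMeasure ν)
    (h : HasLogMomentAtInfinity ν) :
    Tendsto (generator ν lyapunov) (cocompact ℝ) (𝓝 (-2)) := by
  have hjump : Tendsto (fun y => ∫ z, jumpIntegrand lyapunov y z ∂ν) (cocompact ℝ)
      (𝓝 (∫ _, (0 : ℝ) ∂ν)) := by
    have : (cocompact ℝ).IsCountablyGenerated := by
      rw [cocompact_eq_atBot_atTop]
      infer_instance
    refine tendsto_integral_filter_of_dominated_convergence _
      (.of_forall fun y =>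
        (measurable_jumpIntegrand contDiff_lyapunov.continuous y).aestronglyMeasurable)
      (.of_forall fun y => .of_forall (abs_jumpIntegrand_lyapunov_le y))
      (hν.integrable_jumpBound_lyapunov h) (.of_forall fun z => ?_)
    simpa only [jumpIntegrand, zero_mul, sub_zero] using
      (tendsto_lyapunov_add_sub_cocompact z).sub (tendsto_deriv_lyapunov_cocompact.mul_const _)
  rw [integral_zero] at hjump
  exact add_zero (-2 : ℝ) ▸ tendsto_deriv_lyapunov_mul_cocompact.neg.add hjump

lemma IsViscositySubsolution.argmax_nonempty_of_lyapunov (hV : IsViscositySubsolution ν V)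
    (hbdd : BddAbove (range V)) {w : ℝ → ℝ} (hw : ContDiff ℝ 2 w) (hw0 : ∀ y, 0 ≤ w y)
    (hlim : Tendsto w (cocompact ℝ) atTop) (hi : ∀ y, Integrable (jumpIntegrand w y) ν)
    (hgen : ∀ᶠ y in cocompact ℝ, generator ν w y < 0) : (argmax V).Nonempty := by
  obtain ⟨C, hC, hCgen⟩ := mem_cocompact.1 hgen
  have hpert : ∀ ε > 0, ∃ y ∈ C, ∀ x, V x - ε * w x ≤ V y - ε * w y := by
    intro ε hε
    obtain ⟨y, hy⟩ := exists_forall_sub_le_of_tendsto_cocompact hV.1 hbdd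
      (hw.continuous.const_mul ε) (hlim.const_mul_atTop hε)
    refine ⟨y, by_contra fun hyC => ?_, hy⟩
    exact (hV.generator_nonneg hw (hi y) hε hy).not_gt (hCgen hyC)
  obtain ⟨y₁, hy₁, -⟩ := hpert 1 one_pos
  obtain ⟨m, -, hm⟩ := (hV.1.upperSemicontinuousOn C).exists_isMaxOn ⟨y₁, hy₁⟩ hC
  refine ⟨m, fun x => ?_⟩
  have hle : ∀ ε > 0, V x ≤ V m + ε * w x := by
    intro ε hε
    obtain ⟨y, hyC, hy⟩ := hpert ε hε
    have hym : V y ≤ V m := hm hyC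
    linarith [hy x, mul_nonneg hε.le (hw0 y)]
  have hlim₀ : Tendsto (fun ε : ℝ => V m + ε * w x) (𝓝[>] 0) (𝓝 (V m)) := by
    have : Continuous fun ε : ℝ => V m + ε * w x := by fun_prop
    simpa using (this.tendsto 0).mono_left nhdsWithin_le_nhds
  exact ge_of_tendsto hlim₀ (eventually_nhdsWithin_of_forall hle)

lemma IsViscositySubsolution.argmax_nonempty (hV : IsViscositySubsolution ν V)
    (hν : IsLevyMeasure ν) (hlog : HasLogMomentAtInfinity ν) (hbdd : BddAbove (range V)) :
    (argmax V).Nonempty :=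
  hV.argmax_nonempty_of_lyapunov hbdd contDiff_lyapunov lyapunov_nonneg tendsto_lyapunov_cocompact
    (hν.integrable_jumpIntegrand_lyapunov hlog)
    ((hν.tendsto_generator_lyapunov hlog).eventually_lt_const (neg_neg_of_pos two_pos))

end Lyapunov

/-! ### Propagation of maxima along jumps -/

section Propagation

variable {ν : Measure ℝ} {f V : ℝ → ℝ} {y t : ℝ}

lemma generator_neg_of_forall_le (hf : Continuous f) (hi : Integrable (jumpIntegrand f y) ν)
    (hmax : ∀ x, f x ≤ f y) (ht : t ∈ ν.support) (hlt : f (y + t) < f y) :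
    generator ν f y < 0 := by
  have hderiv : deriv f y = 0 := IsLocalMax.deriv_eq_zero (.of_forall hmax)
  have hjump : jumpIntegrand f y = fun z => -(f y - f (y + z)) := by
    ext z
    simp only [jumpIntegrand, hderiv, zero_mul, sub_zero, neg_sub]
  have hi' : Integrable (fun z => f y - f (y + z)) ν := by
    simpa only [hjump, Pi.neg_def, neg_neg] using hi.neg
  have hnhds : {z | 0 < f y - f (y + z)} ∈ 𝓝 t :=
    (isOpen_lt continuous_const (by fun_prop)).mem_nhds (sub_pos.2 hlt)
  have hpos : 0 < ∫ z, (f y - f (y + z)) ∂ν := by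
    rw [integral_pos_iff_support_of_nonneg (fun z => sub_nonneg.2 (hmax _)) hi']
    exact ((Measure.mem_support_iff_forall t).1 ht _ hnhds).trans_le
      (measure_mono fun z hz => ne_of_gt hz)
  rw [generator, hderiv, hjump, integral_neg]
  linarith

lemma IsViscositySubsolution.add_mem_argmax (hV : IsViscositySubsolution ν V)
    (hν : IsLevyMeasure ν) (hy : y ∈ argmax V) (ht : t ∈ ν.support) : y + t ∈ argmax V := by
  by_contra hnot
  obtain ⟨m, hm, hmy⟩ := exists_between (lt_of_notMem_argmax hy hnot)
  obtain ⟨r, hr, hball⟩ := eventually_nhds_iff_ball.1 (hV.1 (y + t) m hm)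
  let b : ContDiffBump (y + t) := ⟨r / 2, r, half_pos hr, half_lt_self hr⟩
  have hbout : ∀ x ∉ ball (y + t) r, b x = 0 := fun x hx => b.zero_of_le_dist (not_lt.1 hx)
  have hby : b y = 0 := hbout y fun h => (hball y h).not_gt hmy
  have hb : ContDiff ℝ 2 fun x => -b x := b.contDiff.neg
  have hi : Integrable (jumpIntegrand (fun x => -b x) y) ν :=
    hν.integrable_jumpIntegrand hb (K := 1)
      (fun x => by rw [abs_neg, abs_of_nonneg b.nonneg]; exact b.le_one) y
  have htouch : ∀ x, V x - (V y - m) * -b x ≤ V y - (V y - m) * -b y := by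
    intro x
    rw [hby]
    by_cases hx : x ∈ ball (y + t) r
    · linarith [hball x hx, mul_le_mul_of_nonneg_left (b.le_one (x := x)) (sub_pos.2 hmy).le]
    · rw [hbout x hx]
      linarith [hy x]
  refine (hV.generator_nonneg hb hi (sub_pos.2 hmy) htouch).not_gt
    (generator_neg_of_forall_le hb.continuous hi (fun x => ?_) ht ?_)
  · simpa only [hby, neg_zero, neg_nonpos] using b.nonneg
  · simpa only [hby, neg_zero, neg_lt_zero] using b.pos_of_mem_ball (mem_ball_self hr)

end Propagation

/-! ### Infinite variation -/

section Variation

variable {ν : Measure ℝ}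

/-- The small jumps have infinite variation: `∫_{|z| ≤ 1} |z| ν(dz) = ∞`. -/
def InfiniteVariation (ν : Measure ℝ) : Prop :=
  ∫⁻ z in {z : ℝ | |z| ≤ 1}, ENNReal.ofReal |z| ∂ν = ⊤

/-- The small positive jumps have infinite variation: `∫_{0 ≤ z ≤ 1} z ν(dz) = ∞`. -/
def InfiniteRightVariation (ν : Measure ℝ) : Prop :=
  ∫⁻ z in Icc 0 1, ENNReal.ofReal z ∂ν = ⊤

lemma Nondegenerate.exists_le_lintegral_abs {p : ℝ} (h : Nondegenerate ν p) (hp : 1 ≤ p) :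
    ∃ c > 0, ∀ δ ∈ Ioc (0 : ℝ) 1, c ≤ ∫⁻ z in {z : ℝ | |z| ≤ δ}, ENNReal.ofReal |z| ∂ν := by
  obtain ⟨-, C, hC, hnd⟩ := h
  refine ⟨ENNReal.ofReal C, ENNReal.ofReal_pos.2 hC, fun δ ⟨hδ0, hδ1⟩ => ?_⟩
  have hpow : C * δ ≤ C * δ ^ (2 - p) := by
    gcongr
    exact (Real.rpow_one δ).symm.trans_le
      (Real.rpow_le_rpow_of_exponent_ge hδ0 hδ1 (by linarith))
  have hsq : ∀ z ∈ {z : ℝ | |z| ≤ δ},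
      ENNReal.ofReal (|z| ^ 2) ≤ ENNReal.ofReal |z| * ENNReal.ofReal δ := fun z hz => by
    rw [← ENNReal.ofReal_mul (abs_nonneg z), sq]
    exact ENNReal.ofReal_le_ofReal (mul_le_mul_of_nonneg_left hz (abs_nonneg z))
  rw [← ENNReal.mul_le_mul_iff_left (ENNReal.ofReal_pos.2 hδ0).ne' ENNReal.ofReal_ne_top]
  calc ENNReal.ofReal C * ENNReal.ofReal δ
      = ENNReal.ofReal (C * δ) := (ENNReal.ofReal_mul hC.le).symm
    _ ≤ ENNReal.ofReal (C * δ ^ (2 - p)) := ENNReal.ofReal_le_ofReal hpow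
    _ ≤ ∫⁻ z in {z : ℝ | |z| ≤ δ}, ENNReal.ofReal (|z| ^ 2) ∂ν := hnd δ hδ0 hδ1
    _ ≤ ∫⁻ z in {z : ℝ | |z| ≤ δ}, ENNReal.ofReal |z| * ENNReal.ofReal δ ∂ν :=
      setLIntegral_mono' (measurableSet_abs_le δ) hsq
    _ = _ := lintegral_mul_const' _ _ ENNReal.ofReal_ne_top

lemma Nondegenerate.infiniteVariation {p : ℝ} (h : Nondegenerate ν p) (hp : 1 ≤ p) :
    InfiniteVariation ν := by
  obtain ⟨c, hc, hle⟩ := h.exists_le_lintegral_abs hp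
  let μ := ν.withDensity fun z => ENNReal.ofReal |z|
  have hμ : ∀ δ, μ {z : ℝ | |z| ≤ δ} = ∫⁻ z in {z : ℝ | |z| ≤ δ}, ENNReal.ofReal |z| ∂ν :=
    fun δ => withDensity_apply _ (measurableSet_abs_le δ)
  have hzero : μ (⋂ δ > (0 : ℝ), {z : ℝ | |z| ≤ δ}) = 0 := by
    have hinter : ⋂ δ > (0 : ℝ), {z : ℝ | |z| ≤ δ} = {0} := by
      ext z
      simp only [mem_iInter, mem_ofPred_eq, mem_singleton_iff, ← abs_nonpos_iff (a := z)]
      exact forall_gt_imp_ge_iff_le_of_dense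
    rw [hinter, withDensity_apply _ (measurableSet_singleton 0), lintegral_singleton, abs_zero,
      ENNReal.ofReal_zero, zero_mul]
  by_contra hfin
  have hlim := tendsto_measure_biInter_gt (μ := μ) (s := fun δ => {z : ℝ | |z| ≤ δ}) (a := 0)
    (fun δ _ => (measurableSet_abs_le δ).nullMeasurableSet)
    (fun δ δ' _ hδ z (hz : |z| ≤ δ) => hz.trans hδ) ⟨1, one_pos, (hμ 1).trans_ne hfin⟩
  rw [hzero] at hlim
  refine hc.not_ge (ge_of_tendsto hlim ?_)
  filter_upwards [Ioc_mem_nhdsGT one_pos] with δ hδ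
  exact (hle δ hδ).trans_eq (hμ δ).symm

lemma setLIntegral_neg {G : Type*} [MeasurableSpace G] [Neg G] [MeasurableNeg G] (μ : Measure G)
    {S : Set G} (hS : MeasurableSet S) {g : G → ENNReal} (hg : Measurable g) :
    ∫⁻ z in S, g z ∂μ.neg = ∫⁻ z in Neg.neg ⁻¹' S, g (-z) ∂μ :=
  setLIntegral_map hS hg measurable_neg

lemma InfiniteVariation.right_or_neg (h : InfiniteVariation ν) :
    InfiniteRightVariation ν ∨ InfiniteRightVariation ν.neg := by
  have hcover : {z : ℝ | |z| ≤ 1} ⊆ Icc 0 1 ∪ Neg.neg ⁻¹' Icc 0 1 := fun z hz =>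
    (le_total 0 z).imp (fun h0 => ⟨h0, (abs_le.1 hz).2⟩)
      fun h0 => ⟨neg_nonneg.2 h0, neg_le.1 (abs_le.1 hz).1⟩
  have hright : ∫⁻ z in Icc 0 1, ENNReal.ofReal |z| ∂ν = ∫⁻ z in Icc 0 1, ENNReal.ofReal z ∂ν :=
    setLIntegral_congr_fun measurableSet_Icc fun z hz => by rw [abs_of_nonneg hz.1]
  have hleft : ∫⁻ z in Neg.neg ⁻¹' Icc 0 1, ENNReal.ofReal |z| ∂ν
      = ∫⁻ z in Icc 0 1, ENNReal.ofReal z ∂ν.neg := by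
    rw [setLIntegral_neg ν measurableSet_Icc ENNReal.measurable_ofReal]
    exact setLIntegral_congr_fun (measurable_neg measurableSet_Icc) fun z hz => by
      rw [abs_of_nonpos (neg_nonneg.1 hz.1)]
  have hsum := (lintegral_mono_set hcover).trans
    (lintegral_union_le (μ := ν) (fun z => ENNReal.ofReal |z|) _ _)
  rw [h, hright, hleft, top_le_iff, ENNReal.add_eq_top] at hsum
  exact hsum

lemma IsLevyMeasure.integrableOn_id_Icc (hν : IsLevyMeasure ν) {r : ℝ} (hr : 0 < r) :
    IntegrableOn (fun z : ℝ => z) (Icc r 1) ν := by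
  refine Measure.integrableOn_of_bounded (M := 1) ?_ (by fun_prop) ?_
  · exact ((measure_mono fun z hz => hz.1.trans (le_abs_self z)).trans_lt
      (hν.measure_le_abs_lt_top hr)).ne
  · refine ae_restrict_of_forall_mem measurableSet_Icc fun z hz => ?_
    rw [Real.norm_of_nonneg (hr.le.trans hz.1)]
    exact hz.2

lemma InfiniteRightVariation.eventually_lt_integral (h : InfiniteRightVariation ν)
    (hν : IsLevyMeasure ν) (L : ℝ) : ∀ᶠ r in 𝓝[>] 0, L < ∫ z in Icc r 1, z ∂ν := by
  have hcover : AECover (ν.restrict (Ioc 0 1)) (𝓝[>] (0 : ℝ)) fun r => Icc r 1 := by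
    refine ⟨ae_restrict_of_forall_mem measurableSet_Ioc fun z hz => ?_, fun _ => measurableSet_Icc⟩
    filter_upwards [Ioo_mem_nhdsGT (show (0 : ℝ) < z from hz.1)] with r hr using ⟨hr.2.le, hz.2⟩
  have hlim := hcover.lintegral_tendsto_of_countably_generated
    ENNReal.measurable_ofReal.aemeasurable
  rw [setLIntegral_congr (Ioc_ae_eq_Icc' hν.zero_mass), h] at hlim
  filter_upwards [self_mem_nhdsWithin, hlim.eventually_const_lt (ENNReal.ofReal_lt_top (r := L))]
    with r hr hlt
  have hsub : Icc r 1 ⊆ Ioc 0 1 := fun z hz => ⟨lt_of_lt_of_le hr hz.1, hz.2⟩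
  rw [Measure.restrict_restrict measurableSet_Icc, inter_eq_left.2 hsub,
    ← ofReal_integral_eq_lintegral_ofReal (hν.integrableOn_id_Icc hr)
      (ae_restrict_of_forall_mem measurableSet_Icc fun z hz => (hsub hz).1.le)] at hlt
  exact lt_of_not_ge fun hle => hlt.not_ge (ENNReal.ofReal_le_ofReal hle)

lemma InfiniteRightVariation.frequently_mem_support (h : InfiniteRightVariation ν)
    (hν : IsLevyMeasure ν) : ∃ᶠ t in 𝓝[>] 0, t ∈ ν.support := by
  intro hnot
  obtain ⟨δ, hδ, hδν⟩ := mem_nhdsGT_iff_exists_Ioo_subset.1 hnot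
  have hnull : ν (Ioo 0 δ) = 0 := measure_mono_null hδν Measure.measure_compl_support
  have hcover : Icc (0 : ℝ) 1 ⊆ {0} ∪ Ioo 0 δ ∪ Icc δ 1 := fun z hz =>
    (lt_or_ge z δ).imp (fun hzδ => hz.1.eq_or_lt'.imp id fun h0 => ⟨h0, hzδ⟩) fun h => ⟨h, hz.2⟩
  have hfin := (lintegral_mono_set hcover).trans
    (lintegral_union_le (μ := ν) (fun z => ENNReal.ofReal z) _ _)
  rw [setLIntegral_measure_zero _ _ (measure_union_null hν.zero_mass hnull), zero_add, h] at hfin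
  exact ((hν.integrableOn_id_Icc hδ).lintegral_lt_top).not_ge hfin

end Variation

/-! ### The barrier at a least maximum point -/

section Barrier

variable {ν : Measure ℝ} {V : ℝ → ℝ} {a l : ℝ}

/-- The identity `x ↦ x - a` cut off by a bump: a test function of slope `1` at `a` that is
negative only just to the left of `a`. -/
noncomputable def barrier (b : ContDiffBump (0 : ℝ)) (a x : ℝ) : ℝ := (x - a) * b (x - a)

variable (b : ContDiffBump (0 : ℝ))

lemma bump_eq_zero {z : ℝ} (hz : b.rOut ≤ |z|) : b z = 0 :=
  b.zero_of_le_dist (by rwa [dist_zero_right, Real.norm_eq_abs])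

lemma contDiff_barrier (a : ℝ) : ContDiff ℝ 2 (barrier b a) :=
  (contDiff_id.sub contDiff_const).mul (b.contDiff.comp (contDiff_id.sub contDiff_const))

lemma abs_barrier_le (a x : ℝ) : |barrier b a x| ≤ b.rOut := by
  rw [barrier, abs_mul, abs_of_nonneg b.nonneg]
  rcases le_total b.rOut |x - a| with h | h
  · rw [bump_eq_zero b h, mul_zero]
    exact b.rOut_pos.le
  · exact (mul_le_of_le_one_right (abs_nonneg _) b.le_one).trans h

lemma barrier_self (a : ℝ) : barrier b a a = 0 := by
  rw [barrier, sub_self, zero_mul]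

lemma barrier_nonneg {x : ℝ} (hx : x ∉ Icc (a - b.rOut) a) : 0 ≤ barrier b a x := by
  rcases le_or_gt a x with hax | hxa
  · exact mul_nonneg (sub_nonneg.2 hax) b.nonneg
  · have hfar : b.rOut ≤ |x - a| := by
      rw [abs_of_neg (sub_neg.2 hxa)]
      linarith [not_le.1 fun h => hx ⟨h, hxa.le⟩]
    rw [barrier, bump_eq_zero b hfar, mul_zero]

lemma deriv_barrier_self (a : ℝ) : deriv (barrier b a) a = 1 := by
  have hid : HasDerivAt (fun x => x - a) 1 a := (hasDerivAt_id a).sub_const a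
  have hbump : DifferentiableAt ℝ (fun x => b (x - a)) a :=
    (b.contDiff (n := 1).comp (contDiff_id.sub contDiff_const)).differentiable one_ne_zero a
  have hb0 : b 0 = 1 := b.one_of_mem_closedBall (mem_closedBall_self b.rIn_pos.le)
  have hmul := (hid.mul hbump.hasDerivAt).deriv
  simp only [sub_self, hb0, zero_mul, add_zero, mul_one] at hmul
  exact hmul

lemma jumpIntegrand_barrier_self (a z : ℝ) :
    jumpIntegrand (barrier b a) a z = z * b z - {z : ℝ | |z| ≤ 1}.indicator (fun z => z) z := by
  simp only [jumpIntegrand, deriv_barrier_self, barrier, add_sub_cancel_left, sub_self,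
    zero_mul, sub_zero, one_mul]

lemma jumpIntegrand_barrier_self_le (hb : b.rOut ≤ min (-l) 1) (a : ℝ) {z : ℝ}
    (hz : z ∉ Ioo l 0) :
    jumpIntegrand (barrier b a) a z
      ≤ (Iic l).indicator 1 z - (Icc b.rOut 1).indicator (fun z => z) z := by
  have hpos := b.rOut_pos
  obtain ⟨hbl, hb1⟩ := le_min_iff.1 hb
  have hsmall : 0 ≤ z → z * b z ≤ z := fun h0 => mul_le_of_le_one_right h0 b.le_one
  have hlarge : b.rOut ≤ |z| → z * b z = 0 := fun h => by rw [bump_eq_zero b h, mul_zero]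
  rw [jumpIntegrand_barrier_self]
  simp only [indicator_apply, mem_ofPred_eq, mem_Iic, mem_Icc, Pi.one_apply]
  grind

lemma IsLevyMeasure.exists_generator_barrier_neg (hν : IsLevyMeasure ν)
    (hvar : InfiniteRightVariation ν) (hl : l < 0) (hnull : ν (Ioo l 0) = 0) (a : ℝ) :
    ∃ b : ContDiffBump (0 : ℝ), generator ν (barrier b a) a < 0 := by
  obtain ⟨r, hlt, hr, hrl⟩ := ((hvar.eventually_lt_integral hν (ν.real (Iic l) - a)).and
    (Ioc_mem_nhdsGT (lt_min (neg_pos.2 hl) one_pos))).exists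
  let b : ContDiffBump (0 : ℝ) := ⟨r / 2, r, half_pos hr, half_lt_self hr⟩
  have hfin : ν (Iic l) ≠ ⊤ := ((measure_mono fun z hz =>
    (neg_le_neg (mem_Iic.1 hz)).trans (neg_le_abs z)).trans_lt
      (hν.measure_le_abs_lt_top (neg_pos.2 hl))).ne
  have hfar : Integrable ((Iic l).indicator (1 : ℝ → ℝ)) ν :=
    (MeasureTheory.integrableOn_const hfin).integrable_indicator measurableSet_Iic
  have hdrift : Integrable ((Icc r 1).indicator fun z : ℝ => z) ν :=
    (hν.integrableOn_id_Icc hr).integrable_indicator measurableSet_Icc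
  have hle : ∫ z, jumpIntegrand (barrier b a) a z ∂ν ≤ ν.real (Iic l) - ∫ z in Icc r 1, z ∂ν :=
    calc ∫ z, jumpIntegrand (barrier b a) a z ∂ν
        ≤ ∫ z, ((Iic l).indicator (1 : ℝ → ℝ) z - (Icc r 1).indicator (fun z => z) z) ∂ν := by
          refine integral_mono_ae (hν.integrable_jumpIntegrand (contDiff_barrier b a)
            (abs_barrier_le b a) a) (hfar.sub hdrift) ?_
          filter_upwards [measure_eq_zero_iff_ae_notMem.1 hnull] with z hz
          exact jumpIntegrand_barrier_self_le b hrl a hz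
      _ = ν.real (Iic l) - ∫ z in Icc r 1, z ∂ν := by
          rw [integral_sub hfar hdrift, integral_indicator_one measurableSet_Iic,
            integral_indicator measurableSet_Icc]
  refine ⟨b, ?_⟩
  rw [generator, deriv_barrier_self]
  linarith

lemma IsViscositySubsolution.not_isLeast_argmax (hV : IsViscositySubsolution ν V)
    (hν : IsLevyMeasure ν) (hvar : InfiniteRightVariation ν) (hl : l < 0)
    (hnull : ν (Ioo l 0) = 0) : ¬IsLeast (argmax V) a := by
  rintro ⟨ha, hleast⟩
  obtain ⟨b, hneg⟩ := hν.exists_generator_barrier_neg hvar hl hnull a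
  have hsm := contDiff_barrier b a
  have hcont := hν.continuous_generator hsm (abs_barrier_le b a)
  obtain ⟨ε, hε, y, hy, hmax⟩ := exists_pos_exists_mem_forall_sub_mul_le (C := Icc (a - b.rOut) a)
    hV.1 hsm.continuous isCompact_Icc ⟨sub_le_self a b.rOut_pos.le, le_rfl⟩
    (hcont.continuousAt.eventually_lt_const hneg) ha
    (fun x hx hxa => lt_of_notMem_argmax ha fun h => hxa (hx.2.antisymm (hleast h)))
    (fun x hx => (barrier_self b a).trans_le (barrier_nonneg b hx))
  exact (hV.generator_nonneg hsm (hν.integrable_jumpIntegrand hsm (abs_barrier_le b a) y) hε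
    hmax).not_gt hy

lemma IsViscositySubsolution.argmax_eq_univ_of_infiniteRightVariation
    (hV : IsViscositySubsolution ν V) (hν : IsLevyMeasure ν) (hvar : InfiniteRightVariation ν)
    (hne : (argmax V).Nonempty) : argmax V = univ := by
  have hclosed := isClosed_argmax hV.1
  have hadd : ∀ y ∈ argmax V, ∀ t ∈ ν.support, y + t ∈ argmax V :=
    fun y hy t ht => hV.add_mem_argmax hν hy ht
  have hup : IsUpperSet (argmax V) :=
    isUpperSet_of_frequently_nhdsGT hclosed hadd (hvar.frequently_mem_support hν)
  by_cases hleft : ∃ᶠ t in 𝓝[<] 0, t ∈ ν.support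
  · have hdown := isLowerSet_of_frequently_nhdsLT hclosed hadd hleft
    obtain ⟨m, hm⟩ := hne
    exact eq_univ_of_forall fun x => (le_total m x).elim (hup · hm) (hdown · hm)
  · obtain ⟨l, hl, hsub⟩ := mem_nhdsLT_iff_exists_Ioo_subset.1 (not_frequently.1 hleft)
    have hnull : ν (Ioo l 0) = 0 := measure_mono_null hsub Measure.measure_compl_support
    refine eq_univ_of_forall fun x => by_contra fun hx => ?_
    have hbdd : BddBelow (argmax V) := ⟨x, fun y hy => le_of_not_ge fun h => hx (hup h hy)⟩
    exact hV.not_isLeast_argmax hν hvar hl hnull (hclosed.isLeast_csInf hne hbdd)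

end Barrier

/-! ### Reflection -/

section Reflection

variable {ν : Measure ℝ} {V : ℝ → ℝ}

lemma IsLevyMeasure.neg (hν : IsLevyMeasure ν) : IsLevyMeasure ν.neg where
  zero_mass := by
    rw [Measure.neg_apply, neg_singleton, neg_zero, hν.zero_mass]
  integrability := by
    rw [setLIntegral_neg ν (measurableSet_lt (by fun_prop) (by fun_prop)) (by fun_prop),
      Measure.neg_apply]
    simpa only [preimage_ofPred_eq, neg_ofPred, abs_neg] using hν.integrability

lemma jumpIntegrand_comp_neg (f : ℝ → ℝ) (y z : ℝ) :
    jumpIntegrand (fun x => f (-x)) (-y) z = jumpIntegrand f y (-z) := by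
  have hind : {z : ℝ | |z| ≤ 1}.indicator (fun z => z) (-z)
      = -{z : ℝ | |z| ≤ 1}.indicator (fun z => z) z := by
    by_cases hz : |z| ≤ 1 <;> simp [hz]
  simp only [jumpIntegrand, deriv_comp_neg, neg_add, neg_neg, hind, neg_mul, mul_neg]

lemma generator_neg (ν : Measure ℝ) (f : ℝ → ℝ) (y : ℝ) :
    generator ν.neg f y = generator ν (fun x => f (-x)) (-y) := by
  have hmap : ∫ z, jumpIntegrand f y z ∂ν.neg = ∫ z, jumpIntegrand f y (-z) ∂ν :=
    (MeasurableEquiv.neg ℝ).measurableEmbedding.integral_map _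
  simp only [generator, hmap, jumpIntegrand_comp_neg, deriv_comp_neg, neg_neg, neg_mul_neg]

lemma IsViscositySubsolution.comp_neg (hV : IsViscositySubsolution ν V) :
    IsViscositySubsolution ν.neg fun x => V (-x) := by
  refine ⟨hV.1.comp continuous_neg, fun φ y hφ hi hmax => ?_⟩
  have hi' : Integrable (jumpIntegrand (fun x => φ (-x)) (-y)) ν := by
    simp only [funext (jumpIntegrand_comp_neg φ y)]
    exact (MeasurableEquiv.neg ℝ).measurableEmbedding.integrable_map_iff.1 hi
  rw [generator_neg]
  exact hV.2 _ (-y) (hφ.comp contDiff_neg) hi' fun x => by simpa using hmax (-x)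

lemma IsViscositySupersolution.neg (hV : IsViscositySupersolution ν V) :
    IsViscositySubsolution ν fun x => -V x := by
  refine ⟨hV.1.neg, fun φ y hφ hi hmax => ?_⟩
  have hgen := hV.2 (fun x => -1 * φ x) y (contDiff_const.mul hφ)
    (jumpIntegrand_const_mul (-1) φ y ▸ hi.const_mul (-1)) fun x => by linarith [hmax x]
  rwa [generator_const_mul, neg_one_mul, neg_neg, ← neg_nonpos] at hgen

end Reflection

/-! ### The Liouville property -/

section Liouville

variable {ν : Measure ℝ} {V : ℝ → ℝ}

lemma IsViscositySubsolution.argmax_eq_univ_of_infiniteVariation (hV : IsViscositySubsolution ν V)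
    (hν : IsLevyMeasure ν) (hvar : InfiniteVariation ν) (hne : (argmax V).Nonempty) :
    argmax V = univ := by
  rcases hvar.right_or_neg with hright | hleft
  · exact hV.argmax_eq_univ_of_infiniteRightVariation hν hright hne
  · have hreflect : argmax (fun x => V (-x)) = -argmax V := argmax_comp neg_surjective
    have huniv := hV.comp_neg.argmax_eq_univ_of_infiniteRightVariation hν.neg hleft
      (hreflect ▸ hne.neg)
    rwa [hreflect, neg_eq_iff_eq_neg, neg_univ] at huniv

lemma IsViscositySubsolution.exists_eq_const (hV : IsViscositySubsolution ν V)
    (hν : IsLevyMeasure ν) (hlog : HasLogMomentAtInfinity ν)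
    (h : InfiniteVariation ν ∨ Dense (AddSubmonoid.closure ν.support : Set ℝ))
    (hbdd : BddAbove (range V)) : ∃ c, ∀ y, V y = c := by
  have hne := hV.argmax_nonempty hν hlog hbdd
  have huniv : argmax V = univ := h.elim (hV.argmax_eq_univ_of_infiniteVariation hν · hne)
    (eq_univ_of_dense_addSubmonoidClosure (isClosed_argmax hV.1) hne
      fun y hy t ht => hV.add_mem_argmax hν hy ht)
  have hmax : ∀ x, x ∈ argmax V := eq_univ_iff_forall.1 huniv
  exact ⟨V 0, fun y => (hmax 0 y).antisymm (hmax y 0)⟩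

lemma IsViscositySupersolution.exists_eq_const (hV : IsViscositySupersolution ν V)
    (hν : IsLevyMeasure ν) (hlog : HasLogMomentAtInfinity ν)
    (h : InfiniteVariation ν ∨ Dense (AddSubmonoid.closure ν.support : Set ℝ))
    (hbdd : BddBelow (range V)) : ∃ c, ∀ y, V y = c := by
  obtain ⟨c, hc⟩ := hV.neg.exists_eq_const hν hlog h hbdd.range_neg
  exact ⟨-c, fun y => neg_eq_iff_eq_neg.1 (hc y)⟩

lemma HasMomentAtInfinity.hasLogMomentAtInfinity (h : HasMomentAtInfinity ν) :
    HasLogMomentAtInfinity ν := by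
  obtain ⟨q, hq, hfin⟩ := h
  have hle : ∀ z : ℝ, ENNReal.ofReal (Real.log |z|)
      ≤ ENNReal.ofReal q⁻¹ * ENNReal.ofReal (|z| ^ q) := fun z => by
    rw [← ENNReal.ofReal_mul (inv_nonneg.2 hq.le), mul_comm, ← div_eq_mul_inv]
    exact ENNReal.ofReal_le_ofReal (Real.log_le_rpow_div (abs_nonneg z) hq)
  refine (lintegral_mono hle).trans_lt ?_
  rw [lintegral_const_mul' _ _ ENNReal.ofReal_ne_top]
  exact ENNReal.mul_lt_top ENNReal.ofReal_lt_top hfin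

lemma nfoldSum_subset_closure (S : Set ℝ) (n : ℕ) : nfoldSum S n ⊆ AddSubmonoid.closure S := by
  rintro _ ⟨s, hs, rfl⟩
  exact sum_mem fun i _ => AddSubmonoid.subset_closure (hs i)

lemma SupportCovers.dense_closure (h : SupportCovers ν) :
    Dense (AddSubmonoid.closure ν.support : Set ℝ) :=
  dense_univ.mono (h.trans_subset (iUnion_subset (nfoldSum_subset_closure ν.support)))

end Liouville

end LevyOU

theorem theorem3p2_general {ν : Measure ℝ} (hν : LevyOU.IsLevyMeasure ν)
    (hlog : LevyOU.HasLogMomentAtInfinity ν)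
    (h : LevyOU.InfiniteVariation ν ∨ Dense (AddSubmonoid.closure ν.support : Set ℝ)) :
    (∀ V : ℝ → ℝ, BddAbove (range V) → LevyOU.IsViscositySubsolution ν V →
      ∃ c, ∀ y, V y = c) ∧
    (∀ V : ℝ → ℝ, BddBelow (range V) → LevyOU.IsViscositySupersolution ν V →
      ∃ c, ∀ y, V y = c) :=
  ⟨fun _ hbdd hV => hV.exists_eq_const hν hlog h hbdd,
    fun _ hbdd hV => hV.exists_eq_const hν hlog h hbdd⟩

theorem theorem3p2 (ν : MeasureTheory.Measure ℝ) (hν : LevyOU.IsLevyMeasure ν)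
    (p : ℝ) (hA1 : LevyOU.Nondegenerate ν p)
    (hA3 : LevyOU.HasMomentAtInfinity ν)
    (hA2 : p ∈ Set.Ioo (1 : ℝ) 2 ∨ LevyOU.SupportCovers ν) :
    (∀ V : ℝ → ℝ, (∃ K : ℝ, ∀ y, |V y| ≤ K) → LevyOU.IsViscositySubsolution ν V →
      ∃ c : ℝ, ∀ y, V y = c) ∧
    (∀ V : ℝ → ℝ, (∃ K : ℝ, ∀ y, |V y| ≤ K) → LevyOU.IsViscositySupersolution ν V →
      ∃ c : ℝ, ∀ y, V y = c) := by
  have h := theorem3p2_general hν hA3.hasLogMomentAtInfinity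
    (hA2.imp (hA1.infiniteVariation ·.1.le) (·.dense_closure))
  exact ⟨fun V ⟨_, hK⟩ => h.1 V ⟨_, forall_mem_range.2 fun y => (abs_le.1 (hK y)).2⟩,
    fun V ⟨_, hK⟩ => h.2 V ⟨_, forall_mem_range.2 fun y => (abs_le.1 (hK y)).1⟩⟩
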